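/- Let $n\ge 0$ be an integer, $N=\{1,\dots,n\}$, and let $$X_+=\Big\{(x,y,t)\in\{0,1\}^N\times\mathbb R_+^N\times\mathbb R_+:\ \Big(\sum_{i\in N}y_i\Big)^2\le t,\quad y_i(1-x_i)=0\ \text{ for all } i\in N\Big\}\subseteq\mathbb R^N\times\mathbb R^N\times\mathbb R .$$ For $c\in\mathbb R^N$ and $S\subseteq N$ write $c(S)=\sum_{i\in S}c_i$, and use the convention $a/0=\infty$ for $a>0$ and $0/0=0$. Then the closure of the convex hull of $X_+$ is the set of all $(x,y,t)\in\mathbb R^N\times\mathbb R^N\times\mathbb R$ that satisfy the bounds $0\le x\le 1$ and $y\ge 0$ and, for every partition $(L,R)$ of $N$ (either block may be empty), the inequality $$t\ \ge\ \min_{\mu}\ \Big\{\frac{y(L)^2}{1-x(R)+\mu(R)}+\sum_{i\in R}\frac{y_i^2}{x_i-\mu_i}\ :\ 1-x(R)+\mu(R)\ge 0,\ \ \mu_i\le x_i\ (i\in R),\ \ \mu\in\mathbb R_+^R\Big\},$$ where the minimum is taken in the extended reals and is attained whenever $0\le x\le 1$ and $y\ge 0$. -/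

import Mathlib

namespace RankOne

/-- The mixed-integer epigraph `X₊` in the space of triples `(x, y, t)`. -/
def XPlus (n : ℕ) : Set ((Fin n → ℝ) × (Fin n → ℝ) × ℝ) :=
  {p | (∀ i, p.1 i = 0 ∨ p.1 i = 1) ∧ (∀ i, 0 ≤ p.2.1 i) ∧ 0 ≤ p.2.2 ∧
    (∑ i, p.2.1 i) ^ 2 ≤ p.2.2 ∧ ∀ i, p.2.1 i * (1 - p.1 i) = 0}

/-- Division of reals with values in the extended reals, with the convention
`a / 0 = ∞` for `a > 0` and `0 / 0 = 0`. It is only used for `0 ≤ a` and `0 ≤ b`. -/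
noncomputable def extDiv (a b : ℝ) : EReal :=
  if b = 0 then (if 0 < a then ⊤ else 0) else ((a / b : ℝ) : EReal)

/-- `(L, R)` is a partition of the index set; either block may be empty. -/
def IsPartition {n : ℕ} (L R : Finset (Fin n)) : Prop :=
  Disjoint L R ∧ L ∪ R = Finset.univ

/-- The constraints on `μ ∈ ℝ^R`. -/
def feasible {n : ℕ} (R : Finset (Fin n)) (x : Fin n → ℝ) : Set (R → ℝ) :=
  {μ | 0 ≤ 1 - ∑ i ∈ R, x i + ∑ i, μ i ∧ (∀ i : R, μ i ≤ x i) ∧ ∀ i : R, 0 ≤ μ i}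

/-- The function of `μ` that is minimized. -/
noncomputable def objective {n : ℕ} (L R : Finset (Fin n)) (x y : Fin n → ℝ) (μ : R → ℝ) :
    EReal :=
  extDiv ((∑ i ∈ L, y i) ^ 2) (1 - ∑ i ∈ R, x i + ∑ i, μ i)
    + ∑ i : R, extDiv ((y i) ^ 2) (x i - μ i)

/-- The optimal value of the minimization over the feasible `μ`. -/
noncomputable def minValue {n : ℕ} (L R : Finset (Fin n)) (x y : Fin n → ℝ) : EReal :=
  sInf (objective L R x y '' feasible R x)

end RankOne

namespace RankOne

/-! For `b > 0`, `a ^ 2 / b` is the supremum over slopes `g` of `2 * g * a - g ^ 2 * b`, and the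
conventions at `b = 0` fit this. So the objective is a supremum of functions affine in `(x, y, μ)`.
It is therefore lower semicontinuous on the compact feasible set, and the minimum is attained.
Validity: each partition inequality cuts out the projection of a closed convex set along a compact
factor (`lifted`), and that projection contains `XPlus`. Sufficiency: a point outside the closed
hull violates a valid inequality with `t`-coefficient one. Testing that inequality at a few points
of `XPlus` bounds its coefficients (`slope_bounds`). These bounds select a partition and Fenchel
slopes whose minorant implies the inequality (`valid_inequality_of_minValue_le`). -/

lemma coe_sum_real {ι : Type*} (s : Finset ι) (f : ι → ℝ) :
    ((∑ i ∈ s, f i : ℝ) : EReal) = ∑ i ∈ s, (f i : EReal) :=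
  map_sum (⟨⟨Real.toEReal, EReal.coe_zero⟩, EReal.coe_add⟩ : ℝ →+ EReal) f s

/-! ### Fenchel minorants of the objective -/

/-- Fenchel lower bound for the perspective of the square. -/
lemma fenchel_le_extDiv (a g : ℝ) {b : ℝ} (hb : 0 ≤ b) :
    ((2 * g * a - g ^ 2 * b : ℝ) : EReal) ≤ extDiv (a ^ 2) b := by
  unfold extDiv
  split_ifs with h h'
  · exact le_top
  · have : a = 0 := by
      by_contra ha
      exact h' (by positivity)
    simp [this, h]
  · have hb' : 0 < b := lt_of_le_of_ne hb (Ne.symm h)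
    rw [EReal.coe_le_coe_iff, le_div_iff₀ hb']
    nlinarith [sq_nonneg (a - g * b)]

lemma extDiv_sq_of_finite {a b : ℝ} (h : b = 0 → a = 0) :
    extDiv (a ^ 2) b = ((2 * (a / b) * a - (a / b) ^ 2 * b : ℝ) : EReal) := by
  unfold extDiv
  by_cases hb : b = 0
  · simp [hb, h hb]
  · rw [if_neg hb, EReal.coe_eq_coe_iff]
    field_simp
    ring

/-- The Fenchel minorant of the objective with slopes `g₀` (for the block `L`) and `g`
(for the elements of `R`); it is affine in `(x, y, μ)`. -/
def minorant {n : ℕ} (L R : Finset (Fin n)) (x y : Fin n → ℝ) (μ : R → ℝ) (g₀ : ℝ)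
    (g : R → ℝ) : ℝ :=
  (2 * g₀ * ∑ i ∈ L, y i - g₀ ^ 2 * (1 - ∑ i ∈ R, x i + ∑ i, μ i)) +
    ∑ i : R, (2 * g i * y i - g i ^ 2 * (x i - μ i))

variable {n : ℕ} {L R : Finset (Fin n)} {x y : Fin n → ℝ}

lemma minorant_le_objective {μ : R → ℝ} (hμ : μ ∈ feasible R x) (g₀ : ℝ) (g : R → ℝ) :
    (minorant L R x y μ g₀ g : EReal) ≤ objective L R x y μ := by
  unfold minorant objective
  rw [EReal.coe_add, coe_sum_real]
  exact add_le_add (fenchel_le_extDiv _ _ hμ.1)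
    (Finset.sum_le_sum fun i _ => fenchel_le_extDiv _ _ (sub_nonneg.2 (hμ.2.1 i)))

lemma eq_zero_of_forall_mul_le {a t : ℝ} (h : ∀ k : ℝ, 2 * k * a ≤ t) : a = 0 := by
  by_contra ha
  have := h ((t + 1) / (2 * a))
  have e : 2 * ((t + 1) / (2 * a)) * a = t + 1 := by field_simp
  linarith

lemma objective_le_of_minorant_le {μ : R → ℝ} {t : ℝ}
    (h : ∀ g₀ g, minorant L R x y μ g₀ g ≤ t) : objective L R x y μ ≤ (t : EReal) := by
  -- At a zero denominator the minorant is linear in the slope, so boundedness forces a zero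
  -- numerator; no term is `⊤`.
  have h₀ : 1 - ∑ i ∈ R, x i + ∑ i, μ i = 0 → ∑ i ∈ L, y i = 0 := fun hb =>
    eq_zero_of_forall_mul_le (t := t) fun k => by
      have := h k 0
      simpa only [minorant, hb, mul_zero, Pi.zero_apply, zero_mul, sub_zero, ne_eq,
        OfNat.ofNat_ne_zero, not_false_eq_true, zero_pow, Finset.sum_const_zero, add_zero]
        using this
  have h₁ : ∀ i : R, x i - μ i = 0 → y i = 0 := fun j hb =>
    eq_zero_of_forall_mul_le (t := t) fun k => by
      have := h 0 (Pi.single j k)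
      have e : ∑ i : R, (2 * (Pi.single j k : R → ℝ) i * y i -
          (Pi.single j k : R → ℝ) i ^ 2 * (x i - μ i)) = 2 * k * y j := by
        rw [Finset.sum_eq_single j (fun i _ hij => by
          rw [Pi.single_eq_of_ne hij]; ring) (by simp), Pi.single_eq_same, hb]
        ring
      rw [minorant, e] at this
      linarith
  unfold objective
  rw [extDiv_sq_of_finite h₀, Finset.sum_congr rfl fun i _ => extDiv_sq_of_finite (h₁ i),
    ← coe_sum_real, ← EReal.coe_add, EReal.coe_le_coe_iff]
  -- The optimal slope is numerator over denominator; at `0 / 0` it is `0`.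
  exact h _ fun i => y i / (x i - μ i)

lemma objective_eq_iSup {μ : R → ℝ} (hμ : μ ∈ feasible R x) :
    objective L R x y μ = ⨆ g : ℝ × (R → ℝ), (minorant L R x y μ g.1 g.2 : EReal) := by
  refine le_antisymm ?_ (iSup_le fun g => minorant_le_objective hμ _ _)
  refine EReal.le_of_forall_lt_iff_le.1 fun t ht => objective_le_of_minorant_le fun g₀ g => ?_
  exact EReal.coe_le_coe_iff.1
    ((le_iSup (fun g : ℝ × (R → ℝ) => (minorant L R x y μ g.1 g.2 : EReal)) (g₀, g)).trans ht.le)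

/-! ### Attainment of the minimum -/

lemma isCompact_feasible (R : Finset (Fin n)) (x : Fin n → ℝ) : IsCompact (feasible R x) := by
  refine (isCompact_Icc (a := (0 : R → ℝ)) (b := fun i : R => x i)).of_isClosed_subset ?_
    fun μ hμ => ⟨hμ.2.2, hμ.2.1⟩
  have e : feasible R x = {μ : R → ℝ | 0 ≤ 1 - ∑ i ∈ R, x i + ∑ i, μ i} ∩
      Set.Icc 0 (fun i : R => x i) := by
    ext μ
    exact ⟨fun h => ⟨h.1, h.2.2, h.2.1⟩, fun h => ⟨h.1, h.2.2, h.2.1⟩⟩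
  rw [e]
  exact (isClosed_le (by fun_prop) (by fun_prop)).inter isClosed_Icc

lemma exists_objective_eq_minValue (hx : ∀ i, 0 ≤ x i) (L R : Finset (Fin n))
    (y : Fin n → ℝ) : ∃ μ ∈ feasible R x, objective L R x y μ = minValue L R x y := by
  have hne : (feasible R x).Nonempty := by
    refine ⟨fun i => x i, ?_, fun i => le_rfl, fun i => hx i⟩
    rw [Finset.sum_coe_sort R x]
    simp
  have hlsc : LowerSemicontinuousOn (objective L R x y) (feasible R x) := by
    have h : LowerSemicontinuousOn
        (fun μ => ⨆ g : ℝ × (R → ℝ), (minorant L R x y μ g.1 g.2 : EReal)) (feasible R x) :=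
      lowerSemicontinuousOn_iSup fun g => by
        refine Continuous.lowerSemicontinuous ?_ |>.lowerSemicontinuousOn _
        refine continuous_coe_real_ereal.comp ?_
        unfold minorant
        fun_prop
    intro μ hμ c hc
    rw [objective_eq_iSup hμ] at hc
    filter_upwards [h μ hμ c hc, self_mem_nhdsWithin] with ν hν hν'
    rwa [objective_eq_iSup hν']
  obtain ⟨μ, hμ, hmin⟩ := hlsc.exists_isMinOn hne (isCompact_feasible R x)
  refine ⟨μ, hμ, le_antisymm (le_sInf ?_) (sInf_le ⟨μ, hμ, rfl⟩)⟩
  rintro _ ⟨ν, hν, rfl⟩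
  exact hmin hν

/-! ### Validity of the partition inequalities -/

/-- Pairs of a point `(x, y, t)` and a feasible `μ` in the unit box whose objective is at
most `t`. -/
def lifted (L R : Finset (Fin n)) :
    Set (((Fin n → ℝ) × (Fin n → ℝ) × ℝ) × (R → Set.Icc (0 : ℝ) 1)) :=
  {q | (fun i => (q.2 i : ℝ)) ∈ feasible R q.1.1 ∧
    ∀ g₀ g, minorant L R q.1.1 q.1.2.1 (fun i => (q.2 i : ℝ)) g₀ g ≤ q.1.2.2}

lemma isClosed_lifted (L R : Finset (Fin n)) : IsClosed (lifted L R) := by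
  have e : lifted L R = {q | 0 ≤ 1 - ∑ i ∈ R, q.1.1 i + ∑ i, (q.2 i : ℝ)} ∩
      (⋂ i : R, {q | (q.2 i : ℝ) ≤ q.1.1 i}) ∩ (⋂ i : R, {q | 0 ≤ (q.2 i : ℝ)}) ∩
      ⋂ g₀, ⋂ g, {q | minorant L R q.1.1 q.1.2.1 (fun i => (q.2 i : ℝ)) g₀ g ≤ q.1.2.2} := by
    ext q
    simp only [lifted, feasible, Set.mem_ofPred_eq, Set.mem_inter_iff, Set.mem_iInter, and_assoc]
  rw [e]
  refine (((isClosed_le (by fun_prop) (by fun_prop)).inter (isClosed_iInter fun i =>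
    isClosed_le (by fun_prop) (by fun_prop))).inter (isClosed_iInter fun i =>
    isClosed_le (by fun_prop) (by fun_prop))).inter (isClosed_iInter fun g₀ =>
    isClosed_iInter fun g => isClosed_le ?_ (by fun_prop))
  unfold minorant
  fun_prop

/-- For fixed slopes every constraint is an affine inequality in `(x, y, t, μ)`, so convex
combinations of lifts are lifts. -/
lemma convex_image_lifted (L R : Finset (Fin n)) : Convex ℝ (Prod.fst '' lifted L R) := by
  rintro _ ⟨⟨p, μ⟩, ⟨hp, hpm⟩, rfl⟩ _ ⟨⟨q, ν⟩, ⟨hq, hqm⟩, rfl⟩ a b ha hb hab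
  refine ⟨(a • p + b • q, fun i => ⟨a * μ i + b * ν i,
    (convex_Icc (0 : ℝ) 1) (μ i).2 (ν i).2 ha hb hab⟩), ⟨⟨?_, ?_, ?_⟩, ?_⟩, rfl⟩
  · have h₁ := mul_nonneg ha hp.1
    have h₂ := mul_nonneg hb hq.1
    simp only [Prod.fst_add, Prod.smul_fst, Pi.add_apply, Pi.smul_apply, smul_eq_mul,
      Finset.sum_add_distrib, ← Finset.mul_sum] at h₁ h₂ ⊢
    linarith
  · intro i
    have h₁ := mul_le_mul_of_nonneg_left (hp.2.1 i) ha
    have h₂ := mul_le_mul_of_nonneg_left (hq.2.1 i) hb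
    simpa using add_le_add h₁ h₂
  · intro i
    exact add_nonneg (mul_nonneg ha (hp.2.2 i)) (mul_nonneg hb (hq.2.2 i))
  · intro g₀ g
    have h₁ := mul_le_mul_of_nonneg_left (hpm g₀ g) ha
    have h₂ := mul_le_mul_of_nonneg_left (hqm g₀ g) hb
    refine le_trans (le_of_eq ?_) (add_le_add h₁ h₂)
    simp only [minorant, Prod.fst_add, Prod.smul_fst, Prod.snd_add, Prod.smul_snd, Pi.add_apply,
      Pi.smul_apply, smul_eq_mul, Finset.sum_add_distrib, ← Finset.mul_sum,
      Finset.sum_sub_distrib, mul_add, mul_sub]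
    have e : b = 1 - a := by linarith
    have s₁ : ∀ (c : ℝ) (f : R → ℝ) (k : R → ℝ),
        ∑ i, k i * (c * f i) = c * ∑ i, k i * f i := fun c f k => by
      rw [Finset.mul_sum]
      exact Finset.sum_congr rfl fun i _ => by ring
    simp only [s₁]
    subst e
    ring

/-- Confining `μ` to the unit box makes the fibre compact, so the projection is a closed map. -/
lemma isClosed_image_lifted (L R : Finset (Fin n)) : IsClosed (Prod.fst '' lifted L R) :=
  isClosedMap_fst_of_compactSpace _ (isClosed_lifted L R)

lemma minValue_le_of_mem_image_lifted {p : (Fin n → ℝ) × (Fin n → ℝ) × ℝ}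
    (hp : p ∈ Prod.fst '' lifted L R) : minValue L R p.1 p.2.1 ≤ ((p.2.2 : ℝ) : EReal) := by
  obtain ⟨⟨p, μ⟩, ⟨hμ, hm⟩, rfl⟩ := hp
  exact (sInf_le (Set.mem_image_of_mem _ hμ)).trans (objective_le_of_minorant_le hm)

lemma sum_add_sum_of_isPartition (h : IsPartition L R) (f : Fin n → ℝ) :
    ∑ i ∈ L, f i + ∑ i ∈ R, f i = ∑ i, f i := by
  rw [← h.2, Finset.sum_union h.1]

lemma XPlus_subset_image_lifted (h : IsPartition L R) :
    XPlus n ⊆ Prod.fst '' lifted L R := by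
  rintro ⟨x, y, t⟩ ⟨hx, hy, ht, hsq, hxy⟩
  simp only at hx hy ht hsq hxy
  set Y := ∑ i, y i with hY
  have hyY : ∀ i, y i ≤ Y := fun i =>
    Finset.single_le_sum (fun j _ => hy j) (Finset.mem_univ i)
  have hY0 : 0 ≤ Y := Finset.sum_nonneg fun i _ => hy i
  have hw0 : ∀ i, 0 ≤ y i / Y := fun i => div_nonneg (hy i) hY0
  have hw : ∀ i, y i / Y * Y = y i := fun i => by
    rcases eq_or_ne Y 0 with h0 | h0
    · rw [h0, mul_zero]
      linarith [hy i, hyY i]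
    · field_simp
  have hwx : ∀ i, y i / Y ≤ x i := fun i => by
    rcases hx i with hi | hi
    · have := hxy i
      rw [hi, sub_zero, mul_one] at this
      rw [this, hi, zero_div]
    · rw [hi]
      exact div_le_one_of_le₀ (hyY i) hY0
  have hx1 : ∀ i, x i ≤ 1 := fun i => by rcases hx i with h | h <;> simp [h]
  have hsplit := sum_add_sum_of_isPartition h y
  have hwR : (∑ i ∈ R, y i / Y) * Y = ∑ i ∈ R, y i := by
    rw [Finset.sum_mul]
    exact Finset.sum_congr rfl fun i _ => hw i
  have hwR1 : ∑ i ∈ R, y i / Y ≤ 1 := by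
    rw [← Finset.sum_div]
    refine div_le_one_of_le₀ ?_ hY0
    linarith [Finset.sum_nonneg fun i (_ : i ∈ L) => hy i]
  have hμ : 1 - ∑ i ∈ R, x i + ∑ i : R, (x i - y i / Y) = 1 - ∑ i ∈ R, y i / Y := by
    rw [Finset.sum_coe_sort R fun i => x i - y i / Y, Finset.sum_sub_distrib]
    ring
  have hterm : ∀ g w a : ℝ, 0 ≤ w → w * Y = a → 2 * g * a - g ^ 2 * w ≤ w * Y ^ 2 := by
    rintro g w _ h0 rfl
    nlinarith [mul_nonneg h0 (sq_nonneg (g - Y))]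
  -- This `μ` makes each denominator its numerator's share of `Y`, so the terms add up to at most `Y
  -- ^ 2 ≤ t`.
  refine ⟨((x, y, t), fun i => ⟨x i - y i / Y, sub_nonneg.2 (hwx i), by
    linarith [hw0 i, hx1 i]⟩), ⟨⟨?_, fun i => ?_, fun i => sub_nonneg.2 (hwx i)⟩, ?_⟩, rfl⟩
  · change 0 ≤ 1 - ∑ i ∈ R, x i + ∑ i : R, (x i - y i / Y)
    linarith
  · exact sub_le_self _ (hw0 i)
  · intro g₀ g
    change minorant L R x y (fun i => x i - y i / Y) g₀ g ≤ t
    unfold minorant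
    rw [hμ]
    have h₁ := hterm g₀ (1 - ∑ i ∈ R, y i / Y) (∑ i ∈ L, y i) (by linarith) (by linarith)
    have h₂ : ∑ i : R, (2 * g i * y i - g i ^ 2 * (x i - (x i - y i / Y))) ≤
        ∑ i : R, y i / Y * Y ^ 2 := by
      refine Finset.sum_le_sum fun i _ => ?_
      rw [sub_sub_cancel]
      exact hterm _ _ _ (hw0 i) (hw i)
    rw [Finset.sum_coe_sort R fun i => y i / Y * Y ^ 2, ← Finset.sum_mul] at h₂
    linarith

lemma isClosed_box (n : ℕ) : IsClosed {p : (Fin n → ℝ) × (Fin n → ℝ) × ℝ |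
    (∀ i, 0 ≤ p.1 i ∧ p.1 i ≤ 1) ∧ ∀ i, 0 ≤ p.2.1 i} := by
  simp only [Set.ofPred_and, Set.ofPred_forall]
  exact (isClosed_iInter fun i => (isClosed_le (by fun_prop) (by fun_prop)).inter
    (isClosed_le (by fun_prop) (by fun_prop))).inter
    (isClosed_iInter fun i => isClosed_le (by fun_prop) (by fun_prop))

lemma convex_box (n : ℕ) : Convex ℝ {p : (Fin n → ℝ) × (Fin n → ℝ) × ℝ |
    (∀ i, 0 ≤ p.1 i ∧ p.1 i ≤ 1) ∧ ∀ i, 0 ≤ p.2.1 i} := by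
  rintro p ⟨hp, hp'⟩ q ⟨hq, hq'⟩ a b ha hb hab
  exact ⟨fun i => (convex_Icc (0 : ℝ) 1) (hp i) (hq i) ha hb hab,
    fun i => (convex_Ici (0 : ℝ)) (hp' i) (hq' i) ha hb hab⟩

lemma XPlus_subset_box (n : ℕ) : XPlus n ⊆ {p : (Fin n → ℝ) × (Fin n → ℝ) × ℝ |
    (∀ i, 0 ≤ p.1 i ∧ p.1 i ≤ 1) ∧ ∀ i, 0 ≤ p.2.1 i} := by
  rintro p ⟨hx, hy, -⟩
  exact ⟨fun i => by rcases hx i with h | h <;> simp [h], hy⟩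

/-! ### Sufficiency of the partition inequalities -/

/-- A point outside the closed convex hull violates a valid inequality for `X₊` in which `t`
has coefficient one. -/
lemma exists_valid_inequality {p : (Fin n → ℝ) × (Fin n → ℝ) × ℝ}
    (hp : p ∉ closure (convexHull ℝ (XPlus n))) :
    ∃ (α β : Fin n → ℝ) (δ : ℝ),
      (∀ q ∈ XPlus n, 0 ≤ q.2.2 + δ + ∑ i, α i * q.1 i - ∑ i, β i * q.2.1 i) ∧
      p.2.2 + δ + ∑ i, α i * p.1 i - ∑ i, β i * p.2.1 i < 0 := by
  obtain ⟨f, u, hfp, hf⟩ := geometric_hahn_banach_point_closed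
    (convex_convexHull ℝ (XPlus n)).closure isClosed_closure hp
  have hfX : ∀ q ∈ XPlus n, u < f q := fun q hq => hf q (subset_closure (subset_convexHull ℝ _ hq))
  set τ := f (0, 0, 1) with hτ
  have hrep : ∀ q : (Fin n → ℝ) × (Fin n → ℝ) × ℝ, f q =
      ∑ i, f (Pi.single i 1, 0, 0) * q.1 i + ∑ i, f (0, Pi.single i 1, 0) * q.2.1 i
        + τ * q.2.2 := by
    rintro ⟨x, y, t⟩
    have e : ((x, y, t) : (Fin n → ℝ) × (Fin n → ℝ) × ℝ) =
        ∑ i, x i • (Pi.single i 1, 0, 0) + ∑ i, y i • (0, Pi.single i 1, 0)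
          + t • (0, 0, 1) := by
      ext j <;> simp [Prod.fst_sum, Prod.snd_sum, Finset.sum_apply, Pi.single_apply]
    rw [congrArg f e]
    simp only [map_add, map_sum, map_smul, smul_eq_mul, hτ]
    simp only [mul_comm]
  have hτ0 : 0 ≤ τ := by
    by_contra hneg
    push Not at hneg
    have h0 := hfX (0, 0, 0) ⟨by simp, by simp, by simp, by simp, by simp⟩
    -- If `τ < 0`, the point `(0, 0, u / τ)` lies in `XPlus` and `f` equals `u` there.
    have hs : (0 : ℝ) ≤ u / τ := by
      refine div_nonneg_of_nonpos ?_ hneg.le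
      rw [hrep] at h0
      simp at h0
      exact h0.le
    have h1 := hfX (0, 0, u / τ) ⟨by simp, by simp, hs, by simpa using hs, by simp⟩
    rw [hrep] at h1
    simp [mul_div_cancel₀ u hneg.ne] at h1
  -- `τ` may vanish. Adding `ε * t` keeps validity, since `t ≥ 0` on `XPlus`, and allows dividing by
  -- `τ + ε`.
  obtain ⟨ε, hε, hεp⟩ : ∃ ε > 0, f p + ε * p.2.2 < u := by
    refine ⟨(u - f p) / (2 * (|p.2.2| + 1)), div_pos (sub_pos.2 hfp) (by positivity), ?_⟩
    have : (u - f p) / (2 * (|p.2.2| + 1)) * p.2.2 ≤ (u - f p) / 2 := by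
      rw [div_mul_eq_mul_div, div_le_div_iff₀ (by positivity) two_pos]
      nlinarith [le_abs_self p.2.2]
    linarith
  have hpos : 0 < τ + ε := by linarith
  have key : ∀ q : (Fin n → ℝ) × (Fin n → ℝ) × ℝ,
      q.2.2 + -u / (τ + ε) + ∑ i, f (Pi.single i 1, 0, 0) / (τ + ε) * q.1 i -
        ∑ i, -f (0, Pi.single i 1, 0) / (τ + ε) * q.2.1 i =
      (f q + ε * q.2.2 - u) / (τ + ε) := by
    intro q
    rw [hrep q]
    simp only [div_mul_eq_mul_div, ← Finset.sum_div, neg_mul, Finset.sum_neg_distrib]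
    field_simp
    ring
  refine ⟨fun i => f (Pi.single i 1, 0, 0) / (τ + ε),
    fun i => -f (0, Pi.single i 1, 0) / (τ + ε), -u / (τ + ε), fun q hq => ?_, ?_⟩
  · rw [key]
    have := mul_nonneg hε.le hq.2.2.1
    exact div_nonneg (by linarith [hfX q hq]) hpos.le
  · rw [key]
    exact div_neg_of_neg_of_pos (by linarith) hpos

/-- Evaluating a valid inequality for `X₊` at the supports `{j | α j < 0}` and
`{i} ∪ {j | α j < 0}` bounds each slope. -/
lemma slope_bounds {α β : Fin n → ℝ} {δ : ℝ}
    (h : ∀ q ∈ XPlus n, 0 ≤ q.2.2 + δ + ∑ i, α i * q.1 i - ∑ i, β i * q.2.1 i) :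
    0 ≤ δ + ∑ j, min (α j) 0 ∧
      ∀ i, (max (β i / 2) 0) ^ 2 ≤ δ + ∑ j, min (α j) 0 + max (α i) 0 := by
  have hmin : ∀ j, α j * (if α j < 0 then 1 else 0) = min (α j) 0 := fun j => by
    split_ifs with hj
    · rw [min_eq_left hj.le, mul_one]
    · rw [min_eq_right (not_lt.1 hj), mul_zero]
  constructor
  · have := h (fun j => if α j < 0 then 1 else 0, 0, 0)
      ⟨fun j => by by_cases hj : α j < 0 <;> simp [hj], by simp, by simp, by simp, by simp⟩
    simpa [hmin] using this
  · intro i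
    -- `s` minimizes `s ^ 2 - β i * s` over `s ≥ 0`, with value `-s ^ 2`.
    set s := max (β i / 2) 0 with hs
    have hs0 : 0 ≤ s := le_max_right _ _
    have := h (fun j => if α j < 0 ∨ j = i then 1 else 0, Pi.single i s, s ^ 2)
      ⟨fun j => by by_cases hj : α j < 0 ∨ j = i <;> simp [hj],
        fun j => by by_cases hj : j = i <;> simp [hj, hs0],
        sq_nonneg s, by simp,
        fun j => by by_cases hj : j = i <;> simp [hj]⟩
    have e : ∑ j, α j * (if α j < 0 ∨ j = i then 1 else 0) = ∑ j, min (α j) 0 + max (α i) 0 := by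
      have e' : ∀ j, α j * (if α j < 0 ∨ j = i then 1 else 0) =
          min (α j) 0 + if j = i then max (α i) 0 else 0 := fun j => by
        rcases eq_or_ne j i with rfl | hj
        · simp [min_add_max]
        · simpa [hj] using hmin j
      simp only [e', Finset.sum_add_distrib, Finset.sum_ite_eq', Finset.mem_univ, if_true]
    have e₂ : ∑ j, β j * (Pi.single i s : Fin n → ℝ) j = β i * s := by
      simp [Pi.single_apply]
    simp only [e, e₂] at this
    have hβ : β i * s = 2 * s ^ 2 := by
      rcases le_total (β i / 2) 0 with hb | hb
      · rw [hs, max_eq_right hb]; ring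
      · rw [hs, max_eq_left hb]; ring
    linarith

/-- A valid inequality for `X₊` is implied by the inequality of a suitable partition. -/
lemma valid_inequality_of_minValue_le {t δ : ℝ} {α β : Fin n → ℝ}
    (hx : ∀ i, 0 ≤ x i ∧ x i ≤ 1) (hy : ∀ i, 0 ≤ y i)
    (ht : ∀ L R : Finset (Fin n), IsPartition L R → minValue L R x y ≤ (t : EReal))
    (h : ∀ q ∈ XPlus n, 0 ≤ q.2.2 + δ + ∑ i, α i * q.1 i - ∑ i, β i * q.2.1 i) :
    0 ≤ t + δ + ∑ i, α i * x i - ∑ i, β i * y i := by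
  obtain ⟨hA, hγ⟩ := slope_bounds h
  set A := δ + ∑ j, min (α j) 0 with hAdef
  set γ : Fin n → ℝ := fun i => max (β i / 2) 0 with hγdef
  have hγ0 : ∀ i, 0 ≤ γ i := fun i => le_max_right _ _
  -- Indices whose slope is at most `√A` share the single slope `√A` of the block `L`; the others
  -- keep their own.
  set R := Finset.univ.filter fun i => A < γ i ^ 2 with hR
  set L := Finset.univ.filter fun i => ¬ A < γ i ^ 2 with hL
  have hLR : IsPartition L R := by
    refine ⟨(Finset.disjoint_filter_filter_not _ _ _).symm, ?_⟩
    rw [Finset.union_comm]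
    exact Finset.filter_union_filter_not_eq _ _
  obtain ⟨μ, hμ, hobj⟩ := exists_objective_eq_minValue (fun i => (hx i).1) L R y
  have hm : minorant L R x y μ (√A) (fun i => γ i) ≤ t := by
    have := minorant_le_objective (y := y) (L := L) hμ (√A) (fun i => γ i)
    rw [hobj] at this
    exact EReal.coe_le_coe_iff.1 (this.trans (ht L R hLR))
  unfold minorant at hm
  rw [Real.sq_sqrt hA] at hm
  have hβ : ∑ i, β i * y i ≤ 2 * √A * ∑ i ∈ L, y i + ∑ i ∈ R, 2 * γ i * y i := by
    rw [← sum_add_sum_of_isPartition hLR, Finset.mul_sum]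
    have hβγ : ∀ i, β i ≤ 2 * γ i := fun i => by
      have := le_max_left (β i / 2) 0
      simp only [hγdef]
      linarith
    refine add_le_add (Finset.sum_le_sum fun i hi => ?_) (Finset.sum_le_sum fun i hi => ?_)
    · have : γ i ≤ √A := Real.le_sqrt_of_sq_le (not_lt.1 (Finset.mem_filter.1 hi).2)
      exact mul_le_mul_of_nonneg_right (by linarith [hβγ i]) (hy i)
    · exact mul_le_mul_of_nonneg_right (hβγ i) (hy i)
  have hα : A * (1 - ∑ i ∈ R, x i) + ∑ i ∈ R, γ i ^ 2 * x i ≤ δ + ∑ i, α i * x i := by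
    have h₁ : ∑ i, (min (α i) 0 + max (α i) 0 * x i) ≤ ∑ i, α i * x i := by
      refine Finset.sum_le_sum fun i _ => ?_
      rcases le_total (α i) 0 with hi | hi
      · rw [min_eq_left hi, max_eq_right hi]
        nlinarith [(hx i).2]
      · rw [min_eq_right hi, max_eq_left hi, zero_add]
    have h₂ : ∑ i ∈ R, (γ i ^ 2 - A) * x i ≤ ∑ i, max (α i) 0 * x i := by
      refine (Finset.sum_le_sum fun i _ => ?_).trans (Finset.sum_le_sum_of_subset_of_nonneg
        (Finset.subset_univ R) fun i _ _ => mul_nonneg (le_max_right _ _) (hx i).1)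
      exact mul_le_mul_of_nonneg_right (by linarith [hγ i]) (hx i).1
    simp only [sub_mul, Finset.sum_sub_distrib, ← Finset.mul_sum, Finset.sum_add_distrib]
      at h₁ h₂
    linarith
  -- In the minorant `μ i` has coefficient `γ i ^ 2 - A`, positive on `R`, so the unknown minimizer
  -- can be dropped.
  have hμR : A * ∑ i, μ i ≤ ∑ i : R, γ i ^ 2 * μ i := by
    rw [Finset.mul_sum]
    exact Finset.sum_le_sum fun i _ =>
      mul_le_mul_of_nonneg_right (Finset.mem_filter.1 i.2).2.le (hμ.2.2 i)
  simp only [mul_sub, Finset.sum_sub_distrib] at hm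
  rw [Finset.sum_coe_sort R fun i => 2 * γ i * y i,
    Finset.sum_coe_sort R fun i => γ i ^ 2 * x i] at hm
  linarith

end RankOne

theorem mainTheorem2 (n : ℕ) :
    (∀ x y : Fin n → ℝ, (∀ i, 0 ≤ x i ∧ x i ≤ 1) → (∀ i, 0 ≤ y i) →
      ∀ L R : Finset (Fin n), RankOne.IsPartition L R →
        ∃ μ ∈ RankOne.feasible R x,
          RankOne.objective L R x y μ = RankOne.minValue L R x y) ∧
    closure (convexHull ℝ (RankOne.XPlus n)) =
      {p : (Fin n → ℝ) × (Fin n → ℝ) × ℝ |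
        (∀ i, 0 ≤ p.1 i ∧ p.1 i ≤ 1) ∧ (∀ i, 0 ≤ p.2.1 i) ∧
        ∀ L R : Finset (Fin n), RankOne.IsPartition L R →
          RankOne.minValue L R p.1 p.2.1 ≤ ((p.2.2 : ℝ) : EReal)} := by
  refine ⟨fun x y hx _ L R _ =>
    RankOne.exists_objective_eq_minValue (fun i => (hx i).1) L R y,
    Set.Subset.antisymm (fun p hp => ?_) ?_⟩
  · have hbox := closure_minimal (convexHull_min (RankOne.XPlus_subset_box n)
      (RankOne.convex_box n)) (RankOne.isClosed_box n) hp
    exact ⟨hbox.1, hbox.2, fun L R hLR => RankOne.minValue_le_of_mem_image_lifted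
      (closure_minimal (convexHull_min (RankOne.XPlus_subset_image_lifted hLR)
        (RankOne.convex_image_lifted L R)) (RankOne.isClosed_image_lifted L R) hp)⟩
  · rintro p ⟨hx, hy, ht⟩
    by_contra hp
    obtain ⟨α, β, δ, hvalid, hviol⟩ := RankOne.exists_valid_inequality hp
    exact hviol.not_ge (RankOne.valid_inequality_of_minValue_le hx hy ht hvalid)
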